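/- **Theorem 2.** Consider a downlink system in which a base station with $N$ antennas serves users with $M$ antennas each, $1\le M<N$. Let a scheduling set be given, choose one user $k$ in it, and replace this user with the best one of $K$ random users, the channels of the other users (the co-users) being fixed. The channels $\mathbf H_\ell\in\mathbb C^{M\times N}$ of the random users $\ell=1,\dots,K$ are independent, $\mathbf H_\ell=\mathbf R_\ell^{1/2}\widetilde{\mathbf H}_\ell$, where $\mathbf R_\ell$ is a positive definite correlation matrix and $\widetilde{\mathbf H}_\ell$ has independent $\mathcal{CN}(0,1)$ entries. For a user with effective channel $\mathbf G\in\mathbb C^{d\times N}$ and semi-unitary precoding matrix $\mathbf W\in\mathbb C^{N\times d}$ ($\mathbf W^H\mathbf W=\mathbf I_d$) the asymptotic high-SNR loss from having to cancel inter-user interference is $$\mathrm{Loss}(\mathbf G,\mathbf W)=\log_2\det(\mathbf G\mathbf G^H)-\log_2\det(\mathbf G\mathbf W\mathbf W^H\mathbf G^H)\in[0,\infty].$$ *BD (block-diagonalization).* The scheduling set has $N/M$ users (with $N/M$ an integer) and the rows of all co-user channels $\mathbf H_j$, $j\neq k$, are linearly independent. User $\ell$, put in the place of $k$, gets $d=M$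 streams, $\mathbf G=\mathbf H_\ell$, and a semi-unitary $\mathbf W_\ell\in\mathbb C^{N\times M}$ with $\mathbf H_j\mathbf W_\ell=\mathbf 0$ for all co-users $j$. *ZFC (zero-forcing with combining).* The scheduling set has $N$ users, with fixed unit-norm combiners $\mathbf c_j$, and the $N-1$ effective co-user channels $\mathbf c_j^H\mathbf H_j$, $j\ne k$, are linearly independent. User $\ell$, put in the place of $k$, gets $d=1$ stream, $\mathbf G=\mathbf c_\ell^H\mathbf H_\ell$ with a unit-norm combiner $\mathbf c_\ell$ that may depend on the channels in any way (for instance the loss-minimizing one), and a unit-norm $\mathbf w_\ell\in\mathbb C^{N}$ with $\mathbf c_j^H\mathbf H_j\mathbf w_\ell=0$ for all co-users $j$. In both cases the best user is the one with the smallest loss, so that $\mathrm{Loss}_{\mathrm{BD}}=\min_{1\le\ell\le K}\mathrm{Loss}(\mathbf H_\ell,\mathbf W_\ell)$ and $\mathrm{Loss}_{\mathrm{ZFC}}=\min_{1\le\ell\le K}\mathrm{Loss}(\mathbf c_\ell^H\mathbf H_\ell,\mathbf w_\ell)$. Then there are constants $c_1,c_2>0$, depending only on $N$ and $M$, such that for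 all sufficiently large $K$ (how large depending only on $N$ and $M$) the numbers $c_1K^{-1/(M(N-M))}$ and $c_2K^{-1/(N-M)}$ are less than $1$ and $$\mathbb E\{\mathrm{Loss}_{\mathrm{BD}}\}\ \ge\ -M\log_2\!\left(1-c_1K^{-\frac1{M(N-M)}}\right),\qquad \mathbb E\{\mathrm{Loss}_{\mathrm{ZFC}}\}\ \ge\ -\log_2\!\left(1-c_2K^{-\frac1{N-M}}\right).$$ -/

import Mathlib

open MeasureTheory ProbabilityTheory
open scoped Matrix MatrixOrder ComplexOrder ENNReal

noncomputable section

/-- The circularly-symmetric complex Gaussian law `CN(0, 1)`: independent real and imaginary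
parts, each centred Gaussian with variance `1/2`. -/
def stdComplexGaussian : Measure ℂ :=
  ((gaussianReal 0 (1 / 2)).prod (gaussianReal 0 (1 / 2))).map
    (fun p : ℝ × ℝ => (⟨p.1, p.2⟩ : ℂ))

/-- `H ℓ`, `ℓ : ι`, are the (random) `M × N` channel matrices of independent users in the Kronecker
model with receive-side correlation matrices `R ℓ` and no transmit-side correlation:
`H ℓ = (R ℓ)^{1/2} H̃ ℓ`, where `R ℓ` is positive definite and the entries of all the matrices
`H̃ ℓ` are independent `CN(0, 1)` variables. -/
def IsKroneckerChannels {Ω ι : Type*} [MeasurableSpace Ω] (P : Measure Ω) {M N : ℕ}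
    (R : ι → Matrix (Fin M) (Fin M) ℂ) (H : ι → Ω → Matrix (Fin M) (Fin N) ℂ) : Prop :=
  (∀ l, (R l).PosDef) ∧
  ∃ Ht : ι → Ω → Matrix (Fin M) (Fin N) ℂ,
    (∀ l i j, HasLaw (fun ω => Ht l ω i j) stdComplexGaussian P) ∧
    iIndepFun (fun (p : ι × Fin M × Fin N) (ω : Ω) => Ht p.1 ω p.2.1 p.2.2) P ∧
    ∀ l ω, H l ω = CFC.sqrt (R l) * Ht l ω

/-- A matrix with orthonormal columns. For a single column: a unit-norm vector. -/
def IsSemiUnitary {m d : ℕ} (A : Matrix (Fin m) (Fin d) ℂ) : Prop :=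
  Aᴴ * A = 1

/-- `W` is a (power-normalized) zero-interference precoding matrix of user `k`, in the set of users
with effective channels `G j`: it is semi-unitary and causes no interference to any co-user.
With `G j = H j` and `d = M` this is block-diagonalization (BD); with `G j = (c j)ᴴ * H j` for
unit-norm combiners `c j` and `d = 1` this is zero-forcing with combining (ZFC). -/
structure IsZeroInterferencePrecoder {ι : Type*} {d N : ℕ} (G : ι → Matrix (Fin d) (Fin N) ℂ)
    (k : ι) (W : Matrix (Fin N) (Fin d) ℂ) : Prop where
  semiUnitary : IsSemiUnitary W
  zeroForcing : ∀ j, j ≠ k → G j * W = 0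

/-- All the rows of the effective channels of the users other than `k` are linearly independent, so
that cancelling the interference to these users uses up one spatial dimension per stream. -/
def CoUsersIndependent {ι : Type*} {d N : ℕ} (G : ι → Matrix (Fin d) (Fin N) ℂ) (k : ι) : Prop :=
  LinearIndependent ℂ (fun p : {j : ι // j ≠ k} × Fin d => G p.1 p.2)

/-- The asymptotic (high-SNR) loss of a user with effective channel `G` and precoding matrix `W`
from having to cancel interference,
`log₂ det (G Gᴴ) - log₂ det (G W Wᴴ Gᴴ)`,
which is infinite if the second determinant vanishes. For semi-unitary `W` the difference is
nonnegative, so that the values in `[0, ∞]` lose nothing. (Both determinants are real and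
nonnegative, being those of positive semidefinite matrices.) -/
def interferenceLoss {d N : ℕ} (G : Matrix (Fin d) (Fin N) ℂ) (W : Matrix (Fin N) (Fin d) ℂ) :
    ℝ≥0∞ :=
  open Classical in
  if (G * W * Wᴴ * Gᴴ).det = 0 then ⊤
  else ENNReal.ofReal (Real.logb 2 (G * Gᴴ).det.re - Real.logb 2 (G * W * Wᴴ * Gᴴ).det.re)

end

/-!
Let `Q` be the orthogonal projection onto the directions that cause no interference to the co-users.
The rank condition makes `W Wᴴ = Q` for every admissible precoder `W`
(`mul_conjTranspose_eq_of_isZeroInterferencePrecoder`), so the loss of a user compares its channel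
with the image of that channel under a *fixed* projection. A loss below `log₂ (1 + σ²)` forces the
Gaussian channel to be nearly aligned with the range of `Q`, and everything rests on the bound
`C σ ^ (2m)` for the probability of this, with `m = M (N - M)` for block-diagonalization and
`m = N - M` for zero-forcing. The union bound over the `K` users with `σ²` of order `K ^ (-1/m)` then
shows that the smallest loss is at least of order `K ^ (-1/m)` with probability `1/2`
(`exists_const_le_lintegral_iInf`). Only elementary inequalities for the logarithm remain.

The small-ball bounds use that linear functions of a Gaussian vector with jointly orthonormal
coefficient vectors are independent `CN(0, 1)` variables (`map_vecMul_pi_stdComplexGaussian`, by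
characteristic functions), and that such a variable lies in a disc of radius `r` with probability
at most `2 r²`. Hence `|α|` of them are all below `σ` times the size of an independent Gaussian
vector with probability at most a constant times `σ ^ (2 |α|)`, the constant being a Gaussian moment
(`pi_stdComplexGaussian_vecMul_lt_le`).

* Block-diagonalization. If the columns of `V` span the range of `Q` and those of `F` its orthogonal
  complement, the loss of `S * Z` is `log₂ det (1 + X Xᴴ)` with `X = (Z V)⁻¹ (Z F)`, whatever the
  invertible `S`. If it is small, then all `M (N - M)` entries of `Z F` are small compared
  with `Z V`, which is independent of them.
* Zero-forcing. If some combination of the rows of `Z` is nearly aligned with the direction `v`, let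
  `i` be the row with the largest coefficient. Choose `N - M` orthonormal directions orthogonal to
  `v` and to the other rows. They see only row `i`, and Bessel's inequality makes the
  components of that row along them small. Conditionally on the other rows these directions are
  fixed, so the same Gaussian bound applies, and no choice of the combiner can evade it.
-/

open scoped Kronecker

/-! ### Complex Gaussian vectors -/

theorem measurable_complex_mk : Measurable (fun p : ℝ × ℝ => (⟨p.1, p.2⟩ : ℂ)) :=
  Complex.measurableEquivRealProd.symm.measurable

instance isProbabilityMeasure_stdComplexGaussian : IsProbabilityMeasure stdComplexGaussian :=
  Measure.isProbabilityMeasure_map measurable_complex_mk.aemeasurable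

theorem charFunDual_stdComplexGaussian (L : StrongDual ℝ ℂ) :
    charFunDual stdComplexGaussian L
      = Complex.exp (-(((L 1) ^ 2 + (L Complex.I) ^ 2 : ℝ) : ℂ) / 4) := by
  have hL (p : ℝ × ℝ) : L (⟨p.1, p.2⟩ : ℂ) = L 1 * p.1 + L Complex.I * p.2 := by
    have : (⟨p.1, p.2⟩ : ℂ) = p.1 • (1 : ℂ) + p.2 • Complex.I := by
      apply Complex.ext <;> simp
    rw [this, map_add, map_smul, map_smul, smul_eq_mul, smul_eq_mul]; ring
  have hg (t : ℝ) : ∫ x : ℝ, Complex.exp (t * x * Complex.I) ∂(gaussianReal 0 (1 / 2))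
      = Complex.exp (-(t : ℂ) ^ 2 / 4) := by
    rw [← charFun_apply_real, charFun_gaussianReal]
    congr 1
    push_cast
    ring
  rw [charFunDual_apply, stdComplexGaussian,
    integral_map measurable_complex_mk.aemeasurable (by fun_prop)]
  simp_rw [hL]
  have (p : ℝ × ℝ) : Complex.exp (((L 1 * p.1 + L Complex.I * p.2 : ℝ) : ℂ) * Complex.I)
      = Complex.exp ((L 1 : ℝ) * p.1 * Complex.I) *
        Complex.exp ((L Complex.I : ℝ) * p.2 * Complex.I) := by
    rw [← Complex.exp_add]; push_cast; ring_nf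
  simp_rw [this]
  rw [integral_prod_mul (fun x : ℝ => Complex.exp ((L 1 : ℝ) * x * Complex.I))
    (fun x : ℝ => Complex.exp ((L Complex.I : ℝ) * x * Complex.I)), hg, hg, ← Complex.exp_add]
  push_cast
  ring_nf

theorem gaussianReal_half_abs_lt_le (r : ℝ) :
    gaussianReal 0 (1 / 2) {x | |x| < r} ≤ ENNReal.ofReal (4 / 3 * r) := by
  rw [gaussianReal_apply _ (by norm_num)]
  -- the density is at most `1 / √π`
  have hpdf (x : ℝ) : gaussianPDF 0 (1 / 2) x ≤ ENNReal.ofReal (2 / 3) := by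
    refine ENNReal.ofReal_le_ofReal ?_
    rw [gaussianPDFReal_def]
    have h1 : Real.exp (-(x - 0) ^ 2 / (2 * ((1 / 2 : NNReal) : ℝ))) ≤ 1 :=
      Real.exp_le_one_iff.2 (by push_cast; nlinarith [sq_nonneg (x - 0)])
    have h2 : (√(2 * Real.pi * ((1 / 2 : NNReal) : ℝ)))⁻¹ ≤ 2 / 3 := by
      rw [inv_le_comm₀ (Real.sqrt_pos.2 (by push_cast; positivity)) (by norm_num)]
      apply Real.le_sqrt_of_sq_le
      push_cast
      nlinarith [Real.pi_gt_three]
    calc _ ≤ (2 / 3 : ℝ) * 1 := mul_le_mul h2 h1 (Real.exp_pos _).le (by norm_num)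
      _ = _ := mul_one _
  calc _ ≤ ∫⁻ x in {x : ℝ | |x| < r}, ENNReal.ofReal (2 / 3) := lintegral_mono fun x => hpdf x
    _ = ENNReal.ofReal (2 / 3) * ENNReal.ofReal (2 * r) := by
      rw [setLIntegral_const]
      congr 1
      have : {x : ℝ | |x| < r} = Set.Ioo (-r) r := by ext; simp [abs_lt]
      rw [this, Real.volume_Ioo]; ring_nf
    _ = _ := by rw [← ENNReal.ofReal_mul (by norm_num)]; ring_nf

/-- A circularly-symmetric Gaussian lies in a disc of radius `r` with probability at most
proportional to the area of the disc. -/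
theorem stdComplexGaussian_enorm_lt_le (r : ℝ≥0∞) :
    stdComplexGaussian {z | ‖z‖ₑ < r} ≤ 2 * r ^ 2 := by
  by_cases hr : r = ⊤
  · simp [hr]
  obtain ⟨r, hr0, rfl⟩ : ∃ x : ℝ, 0 ≤ x ∧ r = ENNReal.ofReal x :=
    ⟨r.toReal, ENNReal.toReal_nonneg, (ENNReal.ofReal_toReal hr).symm⟩
  have hm : MeasurableSet {z : ℂ | ‖z‖ₑ < ENNReal.ofReal r} :=
    measurableSet_lt (by fun_prop) (by fun_prop)
  rw [stdComplexGaussian, Measure.map_apply measurable_complex_mk hm]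
  calc _ ≤ ((gaussianReal 0 (1 / 2)).prod (gaussianReal 0 (1 / 2)))
        ({x : ℝ | |x| < r} ×ˢ {x : ℝ | |x| < r}) := by
        refine measure_mono fun p hp => ?_
        have hp' : ‖(⟨p.1, p.2⟩ : ℂ)‖ < r := by
          have : ‖(⟨p.1, p.2⟩ : ℂ)‖ₑ < ENNReal.ofReal r := hp
          rw [← ofReal_norm] at this
          exact (ENNReal.ofReal_lt_ofReal_iff_of_nonneg (norm_nonneg _)).1 this
        exact ⟨(Complex.abs_re_le_norm _).trans_lt hp', (Complex.abs_im_le_norm _).trans_lt hp'⟩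
    _ ≤ ENNReal.ofReal (4 / 3 * r) * ENNReal.ofReal (4 / 3 * r) := by
        rw [Measure.prod_prod]
        exact mul_le_mul' (gaussianReal_half_abs_lt_le r) (gaussianReal_half_abs_lt_le r)
    _ ≤ 2 * ENNReal.ofReal r ^ 2 := by
        rw [← ENNReal.ofReal_mul (by positivity), ← ENNReal.ofReal_pow hr0,
          ← ENNReal.ofReal_ofNat 2, ← ENNReal.ofReal_mul (by norm_num)]
        exact ENNReal.ofReal_le_ofReal (by nlinarith [sq_nonneg r])

theorem memLp_id_stdComplexGaussian (n : ℕ) :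
    MemLp (id : ℂ → ℂ) n stdComplexGaussian := by
  rw [stdComplexGaussian, memLp_map_measure_iff (by fun_prop) measurable_complex_mk.aemeasurable]
  have h1 : MemLp (fun p : ℝ × ℝ => p.1) n
      ((gaussianReal 0 (1 / 2)).prod (gaussianReal 0 (1 / 2))) :=
    (memLp_id_gaussianReal' (n : ℝ≥0∞) (by simp)).comp_measurePreserving measurePreserving_fst
  have h2 : MemLp (fun p : ℝ × ℝ => p.2) n
      ((gaussianReal 0 (1 / 2)).prod (gaussianReal 0 (1 / 2))) :=
    (memLp_id_gaussianReal' (n : ℝ≥0∞) (by simp)).comp_measurePreserving measurePreserving_snd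
  refine (h1.norm.add h2.norm).mono' measurable_complex_mk.aestronglyMeasurable ?_
  filter_upwards with p
  exact Complex.norm_le_abs_re_add_abs_im _

/-- All absolute moments of the entrywise `ℓ¹` norm of a Gaussian vector are finite. -/
theorem lintegral_sum_enorm_pow_lt_top {ι : Type*} [Fintype ι] (n : ℕ) :
    ∫⁻ z : ι → ℂ, (∑ i, ‖z i‖ₑ) ^ n ∂(Measure.pi fun _ => stdComplexGaussian) < ⊤ := by
  have h : MemLp (fun z : ι → ℂ => ∑ i, ‖z i‖) n (Measure.pi fun _ => stdComplexGaussian) :=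
    memLp_finsetSum _ fun i _ => ((memLp_id_stdComplexGaussian n).comp_measurePreserving
      (measurePreserving_eval (fun _ => stdComplexGaussian) i)).norm
  rcases Nat.eq_zero_or_pos n with rfl | hn
  · simp
  have := lintegral_rpow_enorm_lt_top_of_eLpNorm_lt_top (by exact_mod_cast hn.ne')
    (by simp) h.eLpNorm_lt_top
  refine lt_of_eq_of_lt (lintegral_congr fun z => ?_) this
  rw [Real.enorm_of_nonneg (Finset.sum_nonneg fun i _ => norm_nonneg _),
    ENNReal.ofReal_sum_of_nonneg fun i _ => norm_nonneg _]
  simp [ofReal_norm]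

theorem add_pow_le_two_pow_mul (a b : ℝ≥0∞) (n : ℕ) : (a + b) ^ n ≤ 2 ^ n * (a ^ n + b ^ n) := by
  rcases le_total a b with h | h
  · calc (a + b) ^ n ≤ (2 * b) ^ n := by rw [two_mul]; gcongr
      _ = 2 ^ n * b ^ n := mul_pow _ _ _
      _ ≤ _ := by gcongr; exact le_add_self
  · calc (a + b) ^ n ≤ (2 * a) ^ n := by rw [two_mul]; gcongr
      _ = 2 ^ n * a ^ n := mul_pow _ _ _
      _ ≤ _ := by gcongr; exact le_self_add

theorem lintegral_lintegral_sum_enorm_add_pow_lt_top {ι κ : Type*} [Fintype ι] [Fintype κ]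
    (n : ℕ) :
    ∫⁻ z : ι → ℂ, ∫⁻ y : κ → ℂ, (∑ b, ‖y b‖ₑ + ∑ i, ‖z i‖ₑ) ^ n
      ∂(Measure.pi fun _ => stdComplexGaussian) ∂(Measure.pi fun _ => stdComplexGaussian) < ⊤ := by
  calc _ ≤ ∫⁻ z : ι → ℂ, ∫⁻ y : κ → ℂ, 2 ^ n * ((∑ b, ‖y b‖ₑ) ^ n + (∑ i, ‖z i‖ₑ) ^ n)
        ∂(Measure.pi fun _ => stdComplexGaussian) ∂(Measure.pi fun _ => stdComplexGaussian) :=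
        lintegral_mono fun z => lintegral_mono fun y => add_pow_le_two_pow_mul _ _ n
    _ = 2 ^ n * ((∫⁻ y : κ → ℂ, (∑ b, ‖y b‖ₑ) ^ n ∂(Measure.pi fun _ => stdComplexGaussian))
          + ∫⁻ z : ι → ℂ, (∑ i, ‖z i‖ₑ) ^ n ∂(Measure.pi fun _ => stdComplexGaussian)) := by
        have h (z : ι → ℂ) : ∫⁻ y : κ → ℂ, 2 ^ n * ((∑ b, ‖y b‖ₑ) ^ n + (∑ i, ‖z i‖ₑ) ^ n)
            ∂(Measure.pi fun _ => stdComplexGaussian)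
            = 2 ^ n * ((∫⁻ y : κ → ℂ, (∑ b, ‖y b‖ₑ) ^ n
              ∂(Measure.pi fun _ => stdComplexGaussian)) + (∑ i, ‖z i‖ₑ) ^ n) := by
          rw [lintegral_const_mul _ (by fun_prop), lintegral_add_right _ (by fun_prop),
            lintegral_const, measure_univ, mul_one]
        simp_rw [h]
        rw [lintegral_const_mul _ (by fun_prop), lintegral_add_left (by fun_prop),
          lintegral_const, measure_univ, mul_one]
    _ < ⊤ := ENNReal.mul_lt_top (by simp) (ENNReal.add_lt_top.2
        ⟨lintegral_sum_enorm_pow_lt_top n, lintegral_sum_enorm_pow_lt_top n⟩)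

/-- Linear functions of a Gaussian vector with orthonormal coefficient vectors (the columns of
`F`) are again independent `CN(0, 1)` variables. -/
theorem map_vecMul_pi_stdComplexGaussian {ι κ : Type*} [Fintype ι] [Fintype κ] [DecidableEq ι]
    [DecidableEq κ] (F : Matrix ι κ ℂ) (hF : Fᴴ * F = 1) :
    (Measure.pi fun _ : ι => stdComplexGaussian).map (fun z => z ᵥ* F)
      = Measure.pi fun _ : κ => stdComplexGaussian := by
  let T : (ι → ℂ) →L[ℝ] (κ → ℂ) :=
    LinearMap.toContinuousLinearMap ((Matrix.vecMulLinear F).restrictScalars ℝ)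
  have hT : (fun z : ι → ℂ => z ᵥ* F) = T := rfl
  have : IsProbabilityMeasure ((Measure.pi fun _ : ι => stdComplexGaussian).map T) :=
    Measure.isProbabilityMeasure_map (by fun_prop)
  rw [hT]
  refine Measure.ext_of_charFunDual ?_
  ext L
  rw [charFunDual_map, charFunDual_pi, charFunDual_pi]
  simp_rw [charFunDual_stdComplexGaussian]
  rw [← Complex.exp_sum, ← Complex.exp_sum, ← Finset.sum_div, ← Finset.sum_div,
    Finset.sum_neg_distrib, Finset.sum_neg_distrib, ← Complex.ofReal_sum, ← Complex.ofReal_sum]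
  congr 4
  -- `t k` are the coefficients of the real functional `L` in complex form
  let t : κ → ℂ := fun k => ⟨L (Pi.single k 1), - L (Pi.single k Complex.I)⟩
  have hL (y : κ → ℂ) : L y = (y ⬝ᵥ t).re := by
    have hy : y = ∑ k, ((y k).re • (Pi.single k 1 : κ → ℂ)
        + (y k).im • (Pi.single k Complex.I : κ → ℂ)) := by
      ext k
      simp [Finset.sum_apply, Pi.single_apply, Finset.sum_add_distrib, Complex.re_add_im]
    conv_lhs => rw [hy]
    simp [dotProduct, t]
  have hc (i : ι) (c : ℂ) : T (Pi.single i c) = fun k => c * F i k := by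
    ext k
    show (Pi.single i c ᵥ* F) k = _
    simp
  have h1 : star (F *ᵥ t) ⬝ᵥ (F *ᵥ t) = star t ⬝ᵥ t := by
    rw [Matrix.star_mulVec, ← Matrix.dotProduct_mulVec, Matrix.mulVec_mulVec, hF,
      Matrix.one_mulVec]
  have h2 := congrArg Complex.re h1
  simp only [dotProduct, Complex.re_sum, Pi.star_apply, RCLike.star_def,
    Complex.mul_re, Complex.conj_re, Complex.conj_im] at h2
  have h3 (i : ι) : ((L.comp T).comp (ContinuousLinearMap.single ℝ (fun _ : ι => ℂ) i)) 1
      = ((F *ᵥ t) i).re := by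
    simp [hc, hL, dotProduct, Matrix.mulVec]
  have h4 (i : ι) : ((L.comp T).comp (ContinuousLinearMap.single ℝ (fun _ : ι => ℂ) i)) Complex.I
      = - ((F *ᵥ t) i).im := by
    have : (fun k => Complex.I * F i k) ⬝ᵥ t = Complex.I * (F *ᵥ t) i := by
      simp [dotProduct, Matrix.mulVec, Finset.mul_sum, mul_assoc]
    show L (T (Pi.single i Complex.I)) = _
    rw [hc, hL, this]; simp
  have h5 (k : κ) : (L.comp (ContinuousLinearMap.single ℝ (fun _ : κ => ℂ) k)) 1
      = (t k).re := rfl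
  have h6 (k : κ) : (L.comp (ContinuousLinearMap.single ℝ (fun _ : κ => ℂ) k)) Complex.I
      = -(t k).im := by simp [t]
  simp_rw [h3, h4, h5, h6]
  calc _ = _ := Finset.sum_congr rfl fun i _ => by ring
    _ = _ := h2
    _ = _ := Finset.sum_congr rfl fun i _ => by ring

/-- If the columns of `F` and of `W` are jointly orthonormal, then `z ᵥ* F` and `z ᵥ* W` are
independent Gaussian vectors; so the probability that all the `|α|` entries of the first are smaller
than `σ` times the size of the second is of order `σ ^ (2 |α|)`. -/
theorem pi_stdComplexGaussian_vecMul_lt_le {ι α β : Type*} [Fintype ι] [Fintype α] [Fintype β]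
    [DecidableEq ι] [DecidableEq α] [DecidableEq β] (F : Matrix ι α ℂ) (W : Matrix ι β ℂ)
    (hF : Fᴴ * F = 1) (hW : Wᴴ * W = 1) (hFW : Fᴴ * W = 0) (σ c : ℝ≥0∞) :
    (Measure.pi fun _ : ι => stdComplexGaussian)
        {z | ∀ a, ‖(z ᵥ* F) a‖ₑ < σ * (∑ b, ‖(z ᵥ* W) b‖ₑ + c)}
      ≤ 2 ^ Fintype.card α * σ ^ (2 * Fintype.card α) *
        ∫⁻ y : β → ℂ, (∑ b, ‖y b‖ₑ + c) ^ (2 * Fintype.card α)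
          ∂(Measure.pi fun _ => stdComplexGaussian) := by
  have hU : (Matrix.fromCols F W)ᴴ * Matrix.fromCols F W = 1 := by
    have hWF : Wᴴ * F = 0 := by
      simpa using congrArg Matrix.conjTranspose hFW
    rw [Matrix.conjTranspose_fromCols_eq_fromRows_conjTranspose, Matrix.fromRows_mul_fromCols,
      hF, hW, hFW, hWF, Matrix.fromBlocks_one]
  let S : Set (α ⊕ β → ℂ) :=
    {x | ∀ a, ‖x (Sum.inl a)‖ₑ < σ * (∑ b, ‖x (Sum.inr b)‖ₑ + c)}
  let S' : Set ((α → ℂ) × (β → ℂ)) := {x | ∀ a, ‖x.1 a‖ₑ < σ * (∑ b, ‖x.2 b‖ₑ + c)}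
  have hS : MeasurableSet S := by
    have : S = ⋂ a, {x | ‖x (Sum.inl a)‖ₑ < σ * (∑ b, ‖x (Sum.inr b)‖ₑ + c)} := by
      ext; simp [S]
    rw [this]
    exact MeasurableSet.iInter fun a => measurableSet_lt (by fun_prop) (by fun_prop)
  have hS' : MeasurableSet S' := by
    have : S' = ⋂ a, {x | ‖x.1 a‖ₑ < σ * (∑ b, ‖x.2 b‖ₑ + c)} := by
      ext; simp [S']
    rw [this]
    exact MeasurableSet.iInter fun a => measurableSet_lt (by fun_prop) (by fun_prop)
  have e1 : (Measure.pi fun _ : ι => stdComplexGaussian)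
        {z | ∀ a, ‖(z ᵥ* F) a‖ₑ < σ * (∑ b, ‖(z ᵥ* W) b‖ₑ + c)}
      = (Measure.pi fun _ : α ⊕ β => stdComplexGaussian) S := by
    rw [← map_vecMul_pi_stdComplexGaussian (Matrix.fromCols F W) hU,
      Measure.map_apply (by unfold Matrix.vecMul dotProduct; fun_prop) hS]
    simp [S, Matrix.vecMul_fromCols]
  have e2 : (Measure.pi fun _ : α ⊕ β => stdComplexGaussian) S
      = ((Measure.pi fun _ : α => stdComplexGaussian).prod
          (Measure.pi fun _ : β => stdComplexGaussian)) S' := by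
    rw [← (measurePreserving_sumPiEquivProdPi (fun _ : α ⊕ β => stdComplexGaussian)).measure_preimage
      hS'.nullMeasurableSet]
    rfl
  rw [e1, e2, Measure.prod_apply_symm hS', ← lintegral_const_mul _ (by fun_prop)]
  refine lintegral_mono fun y => ?_
  have e3 : (fun x => (x, y)) ⁻¹' S'
      = Set.univ.pi fun _ : α => {z | ‖z‖ₑ < σ * (∑ b, ‖y b‖ₑ + c)} := by
    ext; simp [S']
  rw [e3, Measure.pi_pi]
  calc _ ≤ ∏ _a : α, 2 * (σ * (∑ b, ‖y b‖ₑ + c)) ^ 2 :=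
        Finset.prod_le_prod' fun _ _ => stdComplexGaussian_enorm_lt_le _
    _ = _ := by
        simp only [Finset.prod_const, Finset.card_univ, mul_pow, ← pow_mul, mul_assoc]

/-- Resampling one row of a Gaussian matrix, with entries indexed by `μ × ν`, does not change its
law. -/
theorem measurePreserving_resample_row {μ ν : Type*} [Fintype μ] [Fintype ν] [DecidableEq μ]
    (i : μ) :
    MeasurePreserving
      (fun (p : (μ × ν → ℂ) × (ν → ℂ)) (q : μ × ν) => if q.1 = i then p.2 q.2 else p.1 q)
      ((Measure.pi fun _ => stdComplexGaussian).prod (Measure.pi fun _ => stdComplexGaussian))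
      (Measure.pi fun _ => stdComplexGaussian) := by
  have hm : Measurable
      (fun (p : (μ × ν → ℂ) × (ν → ℂ)) (q : μ × ν) => if q.1 = i then p.2 q.2 else p.1 q) := by
    refine measurable_pi_lambda _ fun q => ?_
    by_cases h : q.1 = i <;> simp only [h, if_true, if_false] <;> fun_prop
  refine ⟨hm, (Measure.pi_eq fun s hs => ?_).symm⟩
  rw [Measure.map_apply hm (MeasurableSet.univ_pi hs)]
  have : (fun (p : (μ × ν → ℂ) × (ν → ℂ)) (q : μ × ν) => if q.1 = i then p.2 q.2 else p.1 q) ⁻¹'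
        Set.univ.pi s
      = (Set.univ.pi fun q : μ × ν => if q.1 = i then Set.univ else s q) ×ˢ
        (Set.univ.pi fun n => s (i, n)) := by
    ext p
    simp only [Set.mem_preimage, Set.mem_pi, Set.mem_univ, true_implies, Set.mem_prod]
    constructor
    · intro h
      refine ⟨fun q => ?_, fun n => by simpa using h (i, n)⟩
      have := h q
      split_ifs with hq
      · trivial
      · simpa [hq] using this
    · rintro ⟨h1, h2⟩ q
      have h1 := h1 q
      split_ifs at h1 ⊢ with hq
      · rw [← hq] at h2; exact h2 q.2
      · exact h1
  rw [this, Measure.prod_prod, Measure.pi_pi, Measure.pi_pi, Fintype.prod_prod_type,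
    Fintype.prod_prod_type, ← Finset.mul_prod_erase _ _ (Finset.mem_univ i),
    ← Finset.mul_prod_erase Finset.univ (fun x => ∏ y, stdComplexGaussian (s (x, y)))
      (Finset.mem_univ i)]
  simp only [if_true, measure_univ, Finset.prod_const_one, one_mul]
  rw [mul_comm]
  congr 1
  refine Finset.prod_congr rfl fun x hx => ?_
  simp [Finset.ne_of_mem_erase hx]

/-! ### Orthonormal columns and determinants -/

theorem eq_mul_conjTranspose_mulVec_of_mulVec_eq_zero {p ν δ : Type*} [Fintype p] [Fintype ν]
    [Fintype δ] [DecidableEq ν] [DecidableEq δ] {A : Matrix p ν ℂ}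
    (hA : LinearIndependent ℂ A.row)
    (hcard : Fintype.card p + Fintype.card δ = Fintype.card ν) {W : Matrix ν δ ℂ}
    (hW : Wᴴ * W = 1) (hAW : A * W = 0) {x : ν → ℂ} (hx : A *ᵥ x = 0) :
    (W * Wᴴ) *ᵥ x = x := by
  have hr : Module.finrank ℂ (LinearMap.ker A.mulVecLin) = Fintype.card δ := by
    have h1 := LinearMap.finrank_range_add_finrank_ker A.mulVecLin
    have h2 : Module.finrank ℂ (LinearMap.range A.mulVecLin) = Fintype.card p := hA.rank_matrix
    rw [h2, Module.finrank_fintype_fun_eq_card] at h1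
    omega
  let f : (δ → ℂ) →ₗ[ℂ] LinearMap.ker A.mulVecLin :=
    W.mulVecLin.codRestrict _ fun y => by
      rw [LinearMap.mem_ker, Matrix.mulVecLin_apply, Matrix.mulVecLin_apply, Matrix.mulVec_mulVec,
        hAW, Matrix.zero_mulVec]
  have hf : Function.Injective f := by
    intro y z hyz
    have h : W *ᵥ y = W *ᵥ z := congrArg Subtype.val hyz
    simpa [Matrix.mulVec_mulVec, hW] using congrArg (Wᴴ *ᵥ ·) h
  obtain ⟨y, hy⟩ := (LinearMap.injective_iff_surjective_of_finrank_eq_finrank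
    (by rw [hr, Module.finrank_fintype_fun_eq_card])).1 hf
    ⟨x, hx⟩
  have hy : W *ᵥ y = x := congrArg Subtype.val hy
  rw [← hy, Matrix.mulVec_mulVec, Matrix.mul_assoc, hW, Matrix.mul_one]

/-- Both precoders project onto the kernel of the stacked co-user channels, which the rank condition
makes exactly as large as the number of streams; so the projection is determined by the co-users. -/
theorem mul_conjTranspose_eq_of_mul_eq_zero {p ν δ : Type*} [Fintype p] [Fintype ν] [Fintype δ]
    [DecidableEq ν] [DecidableEq δ] {A : Matrix p ν ℂ} (hA : LinearIndependent ℂ A.row)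
    (hcard : Fintype.card p + Fintype.card δ = Fintype.card ν) {W V : Matrix ν δ ℂ}
    (hW : Wᴴ * W = 1) (hAW : A * W = 0) (hV : Vᴴ * V = 1) (hAV : A * V = 0) :
    W * Wᴴ = V * Vᴴ := by
  have key {W V : Matrix ν δ ℂ} (hW : Wᴴ * W = 1) (hAW : A * W = 0) (hAV : A * V = 0) :
      W * Wᴴ * V = V := by
    apply Matrix.ext_of_mulVec_single
    intro i
    rw [← Matrix.mulVec_mulVec]
    exact eq_mul_conjTranspose_mulVec_of_mulVec_eq_zero hA hcard hW hAW
      (by rw [Matrix.mulVec_mulVec, hAV, Matrix.zero_mulVec])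
  have h1 : W * Wᴴ * (V * Vᴴ) = V * Vᴴ := by rw [← Matrix.mul_assoc, key hW hAW hAV]
  have h2 : V * Vᴴ * (W * Wᴴ) = W * Wᴴ := by rw [← Matrix.mul_assoc, key hV hAV hAW]
  have h3 := congrArg Matrix.conjTranspose h1
  simp only [Matrix.conjTranspose_mul, Matrix.conjTranspose_conjTranspose] at h3
  rw [← h2, h3]

theorem exists_orthonormal_columns_orthogonal {ν q : Type*} [Fintype ν] [Fintype q]
    [DecidableEq ν] (X : Matrix ν q ℂ) (e : ℕ) (h : Fintype.card q + e ≤ Fintype.card ν) :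
    ∃ F : Matrix ν (Fin e) ℂ, Fᴴ * F = 1 ∧ Fᴴ * X = 0 := by
  let c : q → EuclideanSpace ℂ ν := fun j => WithLp.toLp 2 (X.col j)
  let K : Submodule ℂ (EuclideanSpace ℂ ν) := Submodule.span ℂ (Set.range c)
  have h1 : Module.finrank ℂ K ≤ Fintype.card q := finrank_range_le_card c
  have h2 := Submodule.finrank_add_finrank_orthogonal K
  rw [finrank_euclideanSpace] at h2
  let b := stdOrthonormalBasis ℂ Kᗮ
  let v : Fin e → EuclideanSpace ℂ ν :=
    fun m => (b (Fin.castLE (by omega) m) : EuclideanSpace ℂ ν)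
  have hv : Orthonormal ℂ v :=
    (b.orthonormal.comp_linearIsometry Kᗮ.subtypeₗᵢ).comp _ (Fin.castLE_injective _)
  refine ⟨Matrix.of fun n m => v m n, ?_, ?_⟩
  · ext m m'
    have := orthonormal_iff_ite.1 hv m m'
    rw [PiLp.inner_apply] at this
    simpa [Matrix.mul_apply, Matrix.one_apply, mul_comm] using this
  · ext m j
    have : inner ℂ (c j) (v m) = 0 :=
      (b (Fin.castLE (by omega) m)).2 (c j) (Submodule.subset_span ⟨j, rfl⟩)
    have := inner_eq_zero_symm.1 this
    rw [PiLp.inner_apply] at this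
    simpa [Matrix.mul_apply, c, mul_comm] using this

theorem ofReal_sum_norm_sq {α : Type*} [Fintype α] (y : α → ℂ) :
    ((∑ n, ‖y n‖ ^ 2 : ℝ) : ℂ) = y ⬝ᵥ star y := by
  simp [dotProduct, Complex.mul_conj, Complex.normSq_eq_norm_sq]

/-- **Bessel's inequality** for the orthonormal columns of `V`. -/
theorem sum_norm_vecMul_sq_le {ν κ : Type*} [Fintype ν] [Fintype κ] [DecidableEq ν]
    [DecidableEq κ] {V : Matrix ν κ ℂ} (hV : Vᴴ * V = 1) (x : ν → ℂ) :
    ∑ k, ‖(x ᵥ* V) k‖ ^ 2 ≤ ∑ n, ‖x n‖ ^ 2 := by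
  have h2 : (((∑ n, ‖x n‖ ^ 2) - ∑ k, ‖(x ᵥ* V) k‖ ^ 2 : ℝ) : ℂ)
      = ((∑ n, ‖(x - (x ᵥ* V) ᵥ* Vᴴ) n‖ ^ 2 : ℝ) : ℂ) := by
    have e1 : x ⬝ᵥ star ((x ᵥ* V) ᵥ* Vᴴ) = (x ᵥ* V) ⬝ᵥ star (x ᵥ* V) := by
      rw [Matrix.star_vecMul, Matrix.conjTranspose_conjTranspose, Matrix.dotProduct_mulVec]
    have e2 : ((x ᵥ* V) ᵥ* Vᴴ) ⬝ᵥ star x = (x ᵥ* V) ⬝ᵥ star (x ᵥ* V) := by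
      rw [← Matrix.dotProduct_mulVec, ← Matrix.star_vecMul]
    have e3 : ((x ᵥ* V) ᵥ* Vᴴ) ⬝ᵥ star ((x ᵥ* V) ᵥ* Vᴴ) = (x ᵥ* V) ⬝ᵥ star (x ᵥ* V) := by
      rw [Matrix.star_vecMul, Matrix.conjTranspose_conjTranspose, Matrix.dotProduct_mulVec,
        Matrix.vecMul_vecMul, hV, Matrix.vecMul_one]
    rw [Complex.ofReal_sub, ofReal_sum_norm_sq, ofReal_sum_norm_sq, ofReal_sum_norm_sq,
      star_sub, sub_dotProduct, dotProduct_sub, dotProduct_sub,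
      e1, e2, e3]
    ring
  have h3 := Complex.ofReal_injective h2
  have h4 : 0 ≤ ∑ n, ‖(x - (x ᵥ* V) ᵥ* Vᴴ) n‖ ^ 2 := by positivity
  linarith

theorem one_add_sum_le_prod_one_add {ι : Type*} (s : Finset ι) (f : ι → ℝ) (hf : ∀ i, 0 ≤ f i) :
    1 + ∑ i ∈ s, f i ≤ ∏ i ∈ s, (1 + f i) := by
  classical
  induction s using Finset.induction_on with
  | empty => simp
  | insert a s ha ih =>
    rw [Finset.sum_insert ha, Finset.prod_insert ha]
    have := Finset.sum_nonneg fun i (_ : i ∈ s) => hf i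
    nlinarith [hf a, mul_le_mul_of_nonneg_left ih (hf a), mul_nonneg (hf a) this]

/-- The determinant of `1 + P` is the product of the `1 + λ i`, with `λ i ≥ 0` the eigenvalues
of `P`. -/
theorem one_add_trace_le_det_one_add {n : Type*} [Fintype n] [DecidableEq n]
    {P : Matrix n n ℂ} (hP : P.PosSemidef) : 1 + P.trace.re ≤ (1 + P).det.re := by
  have hdet : (1 + P).det = ((∏ i, (1 + hP.1.eigenvalues i) : ℝ) : ℂ) := by
    have h := Matrix.eval_charpoly P (-1)
    have hneg : (Matrix.scalar n) (-1) - P = -(1 + P) := by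
      rw [map_neg, map_one]; abel
    rw [hP.1.charpoly_eq, hneg, Matrix.det_neg, Polynomial.eval_prod] at h
    have hfac (i : n) : Polynomial.eval (-1)
        (Polynomial.X - Polynomial.C ((hP.1.eigenvalues i : ℝ) : ℂ))
        = -1 * (1 + (hP.1.eigenvalues i : ℂ)) := by
      simp; ring
    have h' : (-1 : ℂ) ^ Fintype.card n * ∏ i, (1 + (hP.1.eigenvalues i : ℂ))
        = (-1) ^ Fintype.card n * (1 + P).det := by
      rw [← h, ← Finset.card_univ, ← Finset.prod_const, ← Finset.prod_mul_distrib]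
      exact Finset.prod_congr rfl fun i _ => (hfac i).symm
    have := mul_left_cancel₀ (pow_ne_zero _ (by norm_num)) h'
    rw [← this]; push_cast; rfl
  have htr : P.trace.re = ∑ i, hP.1.eigenvalues i := by
    rw [hP.1.trace_eq_sum_eigenvalues]
    simp
  rw [hdet, htr, Complex.ofReal_re]
  exact one_add_sum_le_prod_one_add _ _ hP.eigenvalues_nonneg

/-! ### Lower bounds for the loss of a given channel -/

theorem det_sqrt_ne_zero {M : ℕ} {R : Matrix (Fin M) (Fin M) ℂ} (hR : R.PosDef) :
    (CFC.sqrt R).det ≠ 0 := by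
  intro h
  have h1 := CFC.sqrt_mul_sqrt_self R hR.posSemidef.nonneg
  have h2 := hR.det_pos
  rw [← h1, Matrix.det_mul, h, zero_mul] at h2
  exact lt_irrefl _ h2

theorem det_mul_conjTranspose_re {n : Type*} [Fintype n] [DecidableEq n] (A P : Matrix n n ℂ) :
    (A * P * Aᴴ).det.re = ‖A.det‖ ^ 2 * P.det.re := by
  rw [Matrix.det_mul, Matrix.det_mul, Matrix.det_conjTranspose, mul_right_comm, RCLike.star_def,
    Complex.mul_conj, Complex.normSq_eq_norm_sq, Complex.re_ofReal_mul]

/-- With `A = Z V` the useful and `B = Z F` the lost part of the channel, the loss is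
`log₂ det (1 + X Xᴴ)` for `X = A⁻¹ B`, because the factor `S` cancels; it is infinite if `A` or `S` is
singular. An entry of `B` that is large compared with all of `A` forces an entry of `X` to be
large. -/
theorem logb_le_interferenceLoss_of_le_norm {M N e : ℕ}
    {S : Matrix (Fin M) (Fin M) ℂ} {Z : Matrix (Fin M) (Fin N) ℂ}
    {V W : Matrix (Fin N) (Fin M) ℂ} {F : Matrix (Fin N) (Fin e) ℂ}
    (hVF : V * Vᴴ + F * Fᴴ = 1) (hWV : W * Wᴴ = V * Vᴴ) {σ : ℝ} (hσ : 0 ≤ σ) {i : Fin M}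
    {m : Fin e} (h : σ * ∑ b, ∑ j, ‖(Z * V) b j‖ ≤ ‖(Z * F) i m‖) :
    ENNReal.ofReal (Real.logb 2 (1 + σ ^ 2)) ≤ interferenceLoss (S * Z) W := by
  unfold interferenceLoss
  split_ifs with h0
  · exact le_top
  have hA' : S * Z * W * Wᴴ * (S * Z)ᴴ = (S * (Z * V)) * 1 * (S * (Z * V))ᴴ := by
    rw [Matrix.mul_assoc (S * Z) W, hWV]
    simp only [Matrix.conjTranspose_mul, Matrix.mul_assoc, Matrix.one_mul]
  have hdetA' : (S * (Z * V)).det ≠ 0 := by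
    intro h
    rw [hA', Matrix.det_mul, Matrix.det_mul, h, zero_mul, zero_mul] at h0
    exact h0 rfl
  have hdetA : (Z * V).det ≠ 0 := by
    rw [Matrix.det_mul] at hdetA'
    exact right_ne_zero_of_mul hdetA'
  obtain ⟨X, hX⟩ : ∃ X, Z * F = Z * V * X :=
    ⟨(Z * V)⁻¹ * (Z * F), by
      rw [← Matrix.mul_assoc, Matrix.mul_nonsing_inv _ (isUnit_iff_ne_zero.2 hdetA),
        Matrix.one_mul]⟩
  have hG : (S * Z) * (S * Z)ᴴ = (S * (Z * V)) * (1 + X * Xᴴ) * (S * (Z * V))ᴴ := by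
    calc (S * Z) * (S * Z)ᴴ = S * Z * (V * Vᴴ + F * Fᴴ) * (S * Z)ᴴ := by
          rw [hVF, Matrix.mul_one]
      _ = (S * (Z * V)) * (S * (Z * V))ᴴ + (S * (Z * F)) * (S * (Z * F))ᴴ := by
          simp only [Matrix.conjTranspose_mul, Matrix.mul_assoc, Matrix.mul_add, Matrix.add_mul]
      _ = _ := by
          rw [hX]
          simp only [Matrix.conjTranspose_mul, Matrix.mul_assoc, Matrix.mul_add, Matrix.add_mul,
            Matrix.one_mul]
  have hpos : 0 < ‖(S * (Z * V)).det‖ ^ 2 := by positivity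
  have hexists : ∃ j, σ ≤ ‖X j m‖ := by
    by_contra! hlt
    have h1 : ‖(Z * F) i m‖ ≤ ∑ j, ‖(Z * V) i j‖ * ‖X j m‖ := by
      rw [hX, Matrix.mul_apply]
      exact (norm_sum_le _ _).trans_eq (Finset.sum_congr rfl fun j _ => norm_mul _ _)
    have hne : ∃ j, (Z * V) i j ≠ 0 := by
      by_contra! hz
      exact hdetA (Matrix.det_eq_zero_of_row_eq_zero i hz)
    obtain ⟨j₀, hj₀⟩ := hne
    have h2 : ∑ j, ‖(Z * V) i j‖ * ‖X j m‖ < ∑ j, ‖(Z * V) i j‖ * σ :=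
      Finset.sum_lt_sum (fun j _ => mul_le_mul_of_nonneg_left (hlt j).le (norm_nonneg _))
        ⟨j₀, Finset.mem_univ _, mul_lt_mul_of_pos_left (hlt j₀) (norm_pos_iff.2 hj₀)⟩
    have h3 : ∑ j, ‖(Z * V) i j‖ ≤ ∑ b, ∑ j, ‖(Z * V) b j‖ :=
      Finset.single_le_sum (f := fun b => ∑ j, ‖(Z * V) b j‖)
        (fun b _ => by positivity) (Finset.mem_univ i)
    have h4 := mul_le_mul_of_nonneg_left h3 hσ
    rw [← Finset.sum_mul, mul_comm] at h2
    linarith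
  obtain ⟨j, hj⟩ := hexists
  have htr : σ ^ 2 ≤ (X * Xᴴ).trace.re := by
    have h1 : (X * Xᴴ).trace = ((∑ a, ∑ b, ‖X a b‖ ^ 2 : ℝ) : ℂ) := by
      rw [Complex.ofReal_sum]
      exact Finset.sum_congr rfl fun a _ => (ofReal_sum_norm_sq (X a)).symm
    rw [h1, Complex.ofReal_re]
    calc σ ^ 2 ≤ ‖X j m‖ ^ 2 := pow_le_pow_left₀ hσ hj 2
      _ ≤ ∑ b, ‖X j b‖ ^ 2 := Finset.single_le_sum (f := fun b => ‖X j b‖ ^ 2)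
          (fun b _ => by positivity) (Finset.mem_univ m)
      _ ≤ _ := Finset.single_le_sum (f := fun a => ∑ b, ‖X a b‖ ^ 2)
          (fun b _ => by positivity) (Finset.mem_univ j)
  have hD := one_add_trace_le_det_one_add (Matrix.posSemidef_self_mul_conjTranspose X)
  have hD0 : 0 < (1 + X * Xᴴ).det.re := by nlinarith [sq_nonneg σ]
  apply ENNReal.ofReal_le_ofReal
  rw [hA', hG, det_mul_conjTranspose_re, det_mul_conjTranspose_re, Matrix.det_one, Complex.one_re,
    mul_one, Real.logb_mul hpos.ne' hD0.ne', add_sub_cancel_left]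
  exact Real.logb_le_logb_of_le (by norm_num) (by positivity) (by linarith)

/-- For a one-stream user the loss is the logarithm of the squared ratio of the norm of the channel
to its component along the precoder. -/
theorem logb_le_interferenceLoss_row {N : ℕ} {G : Matrix (Fin 1) (Fin N) ℂ}
    {V W : Matrix (Fin N) (Fin 1) ℂ} (hWV : W * Wᴴ = V * Vᴴ) {σ : ℝ}
    (h : (1 + σ ^ 2) * ‖(G 0 ᵥ* V) 0‖ ^ 2 ≤ ∑ n, ‖G 0 n‖ ^ 2) :
    ENNReal.ofReal (Real.logb 2 (1 + σ ^ 2)) ≤ interferenceLoss G W := by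
  unfold interferenceLoss
  split_ifs with h0
  · exact le_top
  have h1 : (G * W * Wᴴ * Gᴴ).det = ((‖(G 0 ᵥ* V) 0‖ ^ 2 : ℝ) : ℂ) := by
    rw [Matrix.mul_assoc G W, hWV, ← Matrix.mul_assoc, Matrix.mul_assoc,
      ← Matrix.conjTranspose_mul, Matrix.det_fin_one, Matrix.mul_apply, Fin.sum_univ_one,
      Matrix.conjTranspose_apply, RCLike.star_def, Complex.mul_conj, Complex.normSq_eq_norm_sq]
    rfl
  have h2 : (G * Gᴴ).det = ((∑ n, ‖G 0 n‖ ^ 2 : ℝ) : ℂ) := by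
    rw [Matrix.det_fin_one, ofReal_sum_norm_sq]
    rfl
  rw [h1] at h0 ⊢
  rw [h2, Complex.ofReal_re, Complex.ofReal_re]
  have h3 : 0 < ‖(G 0 ᵥ* V) 0‖ ^ 2 :=
    lt_of_le_of_ne (by positivity) fun h => h0 (by rw [← h, Complex.ofReal_zero])
  apply ENNReal.ofReal_le_ofReal
  have h4 := Real.logb_le_logb_of_le (b := 2) (by norm_num) (by positivity) h
  rw [Real.logb_mul (by positivity) h3.ne'] at h4
  linarith

/-! ### The smallest of `K` losses -/

theorem half_le_logb_one_add {s : ℝ} (h0 : 0 ≤ s) (h1 : s ≤ 1) :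
    s / 2 ≤ Real.logb 2 (1 + s) := by
  have hlog2 : 0 < Real.log 2 := Real.log_pos (by norm_num)
  have h2 : Real.log 2 ≤ 1 := by linarith [Real.log_two_lt_d9]
  have h3 := Real.one_sub_inv_le_log_of_pos (x := 1 + s) (by linarith)
  have h4 : s / 2 ≤ 1 - (1 + s)⁻¹ := by
    rw [show 1 - (1 + s)⁻¹ = s / (1 + s) by field_simp; ring]
    exact div_le_div_of_nonneg_left h0 (by linarith) (by linarith)
  rw [Real.logb, le_div_iff₀ hlog2]
  nlinarith

theorem neg_logb_one_sub_le {x : ℝ} (h0 : 0 ≤ x) (h1 : x ≤ 1 / 2) :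
    -Real.logb 2 (1 - x) ≤ 4 * x := by
  have hlog2 : 1 / 2 ≤ Real.log 2 := by linarith [Real.log_two_gt_d9]
  have h3 := Real.one_sub_inv_le_log_of_pos (x := 1 - x) (by linarith)
  have h4 : (1 - x)⁻¹ - 1 ≤ 2 * x := by
    rw [show (1 - x)⁻¹ - 1 = x / (1 - x) by
      have : (1 - x) ≠ 0 := by linarith
      field_simp; ring]
    rw [div_le_iff₀ (by linarith)]
    nlinarith
  rw [Real.logb, ← neg_div, div_le_iff₀ (by linarith)]
  nlinarith

/-- If each of `K` losses falls below `log₂ (1 + σ²)` with probability at most `C σ ^ (2m)`, then by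
the union bound for `σ²` of order `K ^ (-1/m)` the smallest of them exceeds this threshold with
probability at least `1/2`. -/
theorem exists_const_le_lintegral_iInf (m : ℕ) (hm : 1 ≤ m) (C : ℝ≥0∞) (hC : C ≠ ⊤) (D : ℕ)
    (hD : 1 ≤ D) :
    ∃ c : ℝ, 0 < c ∧ ∀ K : ℕ, 1 ≤ K → c * (K : ℝ) ^ (-(1 / (m : ℝ))) < 1 ∧
      ∀ (Ω : Type*) [MeasurableSpace Ω] (P : Measure Ω) [IsProbabilityMeasure P]
        (X : Fin K → Ω → ℝ≥0∞),
        (∀ l, ∀ σ : ℝ, 0 ≤ σ → ∃ E : Set Ω, P E ≤ C * ENNReal.ofReal σ ^ (2 * m) ∧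
          ∀ ω ∉ E, ENNReal.ofReal (Real.logb 2 (1 + σ ^ 2)) ≤ X l ω) →
        ENNReal.ofReal (-(D : ℝ) * Real.logb 2 (1 - c * (K : ℝ) ^ (-(1 / (m : ℝ)))))
          ≤ ∫⁻ ω, ⨅ l : Fin K, X l ω ∂P := by
  obtain ⟨B, hB1, hCB⟩ : ∃ B : ℝ, 1 ≤ B ∧ C ≤ ENNReal.ofReal B :=
    ⟨C.toReal + 1, by linarith [ENNReal.toReal_nonneg (a := C)], by
      conv_lhs => rw [← ENNReal.ofReal_toReal hC]
      exact ENNReal.ofReal_le_ofReal (by linarith)⟩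
  have hm0 : (m : ℝ) ≠ 0 := by positivity
  have hDR : (1 : ℝ) ≤ D := by exact_mod_cast hD
  refine ⟨(2 * B) ^ (-(1 / (m : ℝ))) / (16 * D), by positivity, fun K hK => ?_⟩
  have hKR : (1 : ℝ) ≤ K := by exact_mod_cast hK
  -- the threshold for which the union bound `K * (B * s ^ m)` equals `1 / 2`
  obtain ⟨s, hs⟩ : ∃ s : ℝ, s = (2 * B * K) ^ (-(1 / (m : ℝ))) := ⟨_, rfl⟩
  have hs0 : 0 < s := by rw [hs]; positivity
  have hs1 : s ≤ 1 := by
    rw [hs]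
    exact Real.rpow_le_one_of_one_le_of_nonpos (by nlinarith)
      (by rw [neg_nonpos]; positivity)
  have hsm : s ^ m = (2 * B * K)⁻¹ := by
    rw [hs, ← Real.rpow_natCast, ← Real.rpow_mul (by positivity), neg_mul,
      one_div_mul_cancel hm0, Real.rpow_neg_one]
  have hx : (2 * B) ^ (-(1 / (m : ℝ))) / (16 * D) * (K : ℝ) ^ (-(1 / (m : ℝ)))
      = s / (16 * D) := by
    rw [hs, Real.mul_rpow (x := 2 * B) (y := K) (by positivity) (by positivity)]
    ring
  rw [hx]
  have hx1 : s / (16 * D) ≤ 1 / 2 := by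
    rw [div_le_div_iff₀ (by positivity) (by norm_num)]
    linarith
  refine ⟨by linarith, fun Ω _ P _ X hX => ?_⟩
  choose E hE hEX using fun l => hX l (√s) (Real.sqrt_nonneg s)
  simp only [Real.sq_sqrt hs0.le] at hEX
  -- neither the events nor the losses need be measurable
  let A : Set Ω := toMeasurable P (⋃ l, E l)
  have hA : P A ≤ ENNReal.ofReal (1 / 2) := by
    calc P A = P (⋃ l, E l) := measure_toMeasurable _
      _ ≤ ∑ l, P (E l) := measure_iUnion_fintype_le _ _
      _ ≤ ∑ _l : Fin K, ENNReal.ofReal B * ENNReal.ofReal (√s) ^ (2 * m) :=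
          Finset.sum_le_sum fun l _ => (hE l).trans (mul_le_mul_left hCB _)
      _ = ENNReal.ofReal (K * (B * s ^ m)) := by
          rw [Finset.sum_const, Finset.card_univ, Fintype.card_fin, nsmul_eq_mul,
            ENNReal.ofReal_mul (by positivity), ENNReal.ofReal_mul (by positivity),
            ENNReal.ofReal_natCast, pow_mul, ← ENNReal.ofReal_pow (Real.sqrt_nonneg s),
            Real.sq_sqrt hs0.le, ENNReal.ofReal_pow hs0.le]
      _ = ENNReal.ofReal (1 / 2) := by
          rw [hsm]
          congr 1
          field_simp
  have hAc : ENNReal.ofReal (1 / 2) ≤ P Aᶜ := by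
    rw [prob_compl_eq_one_sub (measurableSet_toMeasurable _ _)]
    refine ENNReal.le_sub_of_add_le_left (measure_ne_top _ _) ?_
    calc P A + ENNReal.ofReal (1 / 2) ≤ ENNReal.ofReal (1 / 2) + ENNReal.ofReal (1 / 2) :=
          add_le_add_left hA _
      _ = 1 := by rw [← ENNReal.ofReal_add (by norm_num) (by norm_num)]; norm_num
  calc ENNReal.ofReal (-(D : ℝ) * Real.logb 2 (1 - s / (16 * D)))
      ≤ ENNReal.ofReal (s / 2 * (1 / 2)) := by
        apply ENNReal.ofReal_le_ofReal
        have h1 := mul_le_mul_of_nonneg_left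
          (neg_logb_one_sub_le (x := s / (16 * D)) (by positivity) hx1)
          (show (0 : ℝ) ≤ D by positivity)
        have h2 : (D : ℝ) * (4 * (s / (16 * D))) = s / 2 * (1 / 2) := by
          field_simp
          norm_num
        linarith
    _ = ENNReal.ofReal (s / 2) * ENNReal.ofReal (1 / 2) := ENNReal.ofReal_mul (by positivity)
    _ ≤ ENNReal.ofReal (s / 2) * P Aᶜ := mul_le_mul_right hAc _
    _ = ∫⁻ ω, Aᶜ.indicator (fun _ => ENNReal.ofReal (s / 2)) ω ∂P := by
        rw [lintegral_indicator_const (measurableSet_toMeasurable _ _).compl]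
    _ ≤ ∫⁻ ω, ⨅ l : Fin K, X l ω ∂P := by
        refine lintegral_mono fun ω => ?_
        by_cases hω : ω ∈ A
        · simp [hω]
        · rw [Set.indicator_of_mem hω]
          refine le_iInf fun l => (ENNReal.ofReal_le_ofReal
            (half_le_logb_one_add hs0.le hs1)).trans (hEX l ω fun h => hω ?_)
          exact subset_toMeasurable _ _ (Set.mem_iUnion_of_mem l h)

/-! ### The precoders and the law of the channels -/

theorem mul_conjTranspose_eq_of_isZeroInterferencePrecoder {ι : Type*} [Fintype ι] [DecidableEq ι]
    {d N : ℕ} {G : ι → Matrix (Fin d) (Fin N) ℂ} {k : ι} (hG : CoUsersIndependent G k)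
    (hN : Fintype.card ι * d = N) {G₁ G₂ : Matrix (Fin d) (Fin N) ℂ}
    {W V : Matrix (Fin N) (Fin d) ℂ}
    (hW : IsZeroInterferencePrecoder (Function.update G k G₁) k W)
    (hV : IsZeroInterferencePrecoder (Function.update G k G₂) k V) : W * Wᴴ = V * Vᴴ := by
  let A : Matrix ({j : ι // j ≠ k} × Fin d) (Fin N) ℂ := Matrix.of fun p => G p.1 p.2
  have hz {G' : Matrix (Fin d) (Fin N) ℂ} {U : Matrix (Fin N) (Fin d) ℂ}
      (hU : IsZeroInterferencePrecoder (Function.update G k G') k U) : A * U = 0 := by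
    ext p i
    have := hU.zeroForcing p.1 p.1.2
    rw [Function.update_of_ne p.1.2] at this
    exact congrFun (congrFun this p.2) i
  refine mul_conjTranspose_eq_of_mul_eq_zero (A := A) hG ?_ hW.semiUnitary (hz hW)
    hV.semiUnitary (hz hV)
  have hpos : 0 < Fintype.card ι := Fintype.card_pos_iff.2 ⟨k⟩
  rw [Fintype.card_prod, Fintype.card_fin, Fintype.card_fin, ← hN, Fintype.card_subtype_compl,
    Fintype.card_subtype_eq, ← Nat.succ_mul, Nat.succ_eq_add_one, Nat.sub_add_cancel hpos]

theorem IsKroneckerChannels.exists_hasLaw {Ω ι : Type*} [MeasurableSpace Ω] {P : Measure Ω}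
    {M N : ℕ} {R : ι → Matrix (Fin M) (Fin M) ℂ} {H : ι → Ω → Matrix (Fin M) (Fin N) ℂ}
    (h : IsKroneckerChannels P R H) (l : ι) :
    ∃ Z : Ω → Fin M × Fin N → ℂ, HasLaw Z (Measure.pi fun _ => stdComplexGaussian) P ∧
      ∀ ω, H l ω = CFC.sqrt (R l) * Matrix.of (Function.curry (Z ω)) := by
  obtain ⟨-, Ht, hlaw, hind, hH⟩ := h
  refine ⟨fun ω q => Ht l ω q.1 q.2, ?_, fun ω => hH l ω⟩
  exact (hind.precomp (g := fun q : Fin M × Fin N => (l, q)) (Prod.mk_right_injective l)).hasLaw_pi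
    fun q => hlaw l q.1 q.2

/-! ### Block-diagonalization -/

/-- The Gaussian small-ball estimate behind block-diagonalization: `N - M` columns orthogonal to the
precoder give `M (N - M)` entries that all have to be small. -/
theorem exists_const_pi_stdComplexGaussian_mul_lt_le (M e : ℕ) :
    ∃ C : ℝ≥0∞, C ≠ ⊤ ∧ ∀ {N : ℕ} (V : Matrix (Fin N) (Fin M) ℂ) (F : Matrix (Fin N) (Fin e) ℂ),
      Vᴴ * V = 1 → Fᴴ * F = 1 → Fᴴ * V = 0 → ∀ σ : ℝ≥0∞,
      (Measure.pi fun _ : Fin M × Fin N => stdComplexGaussian)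
        {z | ∀ i m, ‖(Matrix.of (Function.curry z) * F) i m‖ₑ
          < σ * ∑ b, ∑ j, ‖(Matrix.of (Function.curry z) * V) b j‖ₑ} ≤ C * σ ^ (2 * (M * e)) := by
  refine ⟨2 ^ (M * e) * ∫⁻ y : Fin M × Fin M → ℂ, (∑ b, ‖y b‖ₑ) ^ (2 * (M * e))
    ∂(Measure.pi fun _ => stdComplexGaussian),
    ENNReal.mul_ne_top (by simp) (lintegral_sum_enorm_pow_lt_top _).ne, ?_⟩
  intro N V F hV hF hFV σ
  have hk {a b : ℕ} (X : Matrix (Fin N) (Fin a) ℂ) (Y : Matrix (Fin N) (Fin b) ℂ) :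
      ((1 : Matrix (Fin M) (Fin M) ℂ) ⊗ₖ X)ᴴ
          * ((1 : Matrix (Fin M) (Fin M) ℂ) ⊗ₖ Y)
        = (1 : Matrix (Fin M) (Fin M) ℂ) ⊗ₖ (Xᴴ * Y) := by
    rw [Matrix.conjTranspose_kronecker, Matrix.conjTranspose_one]
    simpa using (Matrix.mul_kronecker_mul (1 : Matrix (Fin M) (Fin M) ℂ) 1 Xᴴ Y).symm
  have hvec {a : ℕ} (X : Matrix (Fin N) (Fin a) ℂ) (z : Fin M × Fin N → ℂ) (q : Fin M × Fin a) :
      (z ᵥ* ((1 : Matrix (Fin M) (Fin M) ℂ) ⊗ₖ X)) q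
        = (Matrix.of (Function.curry z) * X) q.1 q.2 := by
    simp [Matrix.vecMul, dotProduct, Matrix.mul_apply, Fintype.sum_prod_type, Matrix.one_apply,
      Matrix.kroneckerMap_apply]
  have h := pi_stdComplexGaussian_vecMul_lt_le
    ((1 : Matrix (Fin M) (Fin M) ℂ) ⊗ₖ F)
    ((1 : Matrix (Fin M) (Fin M) ℂ) ⊗ₖ V)
    (by rw [hk, hF]; exact Matrix.one_kronecker_one) (by rw [hk, hV]; exact Matrix.one_kronecker_one)
    (by rw [hk, hFV]; exact Matrix.kronecker_zero _) σ 0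
  simp only [hvec, add_zero, Fintype.card_prod, Fintype.card_fin, Fintype.sum_prod_type,
    Prod.forall] at h
  refine h.trans_eq ?_
  simp only [Fintype.sum_prod_type]
  ring

theorem add_mul_conjTranspose_eq_one {N d e : ℕ} (h : d + e = N) {V : Matrix (Fin N) (Fin d) ℂ}
    {F : Matrix (Fin N) (Fin e) ℂ} (hV : Vᴴ * V = 1) (hF : Fᴴ * F = 1) (hFV : Fᴴ * V = 0) :
    V * Vᴴ + F * Fᴴ = 1 := by
  have hVF : Vᴴ * F = 0 := by simpa using congrArg Matrix.conjTranspose hFV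
  rw [← Matrix.fromCols_mul_fromRows, Matrix.mul_eq_one_comm_of_card_eq _ _ _ (by simp [h]),
    Matrix.fromRows_mul_fromCols, hV, hF, hFV, hVF, Matrix.fromBlocks_one]

theorem sum_sum_enorm {m n : Type*} [Fintype m] [Fintype n] (A : Matrix m n ℂ) :
    ∑ i, ∑ j, ‖A i j‖ₑ = ENNReal.ofReal (∑ i, ∑ j, ‖A i j‖) := by
  have key (f : m → n → ℂ) : ∑ i, ∑ j, ‖f i j‖ₑ = ENNReal.ofReal (∑ i, ∑ j, ‖f i j‖) := by
    rw [ENNReal.ofReal_sum_of_nonneg fun i _ => Finset.sum_nonneg fun j _ => norm_nonneg _]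
    refine Finset.sum_congr rfl fun i _ => ?_
    rw [ENNReal.ofReal_sum_of_nonneg fun j _ => norm_nonneg _]
    simp only [ofReal_norm]
  exact key A

/-- The small-ball estimate for the loss of a single random user under block-diagonalization. -/
theorem exists_const_measure_interferenceLoss_lt_le (N M : ℕ) (hMN : M < N) :
    ∃ C : ℝ≥0∞, C ≠ ⊤ ∧ ∀ {ι : Type*} [Fintype ι] [DecidableEq ι], Fintype.card ι * M = N →
      ∀ {G : ι → Matrix (Fin M) (Fin N) ℂ} {k : ι}, CoUsersIndependent G k →
      ∀ {Ω κ : Type*} [MeasurableSpace Ω] {P : Measure Ω} [IsProbabilityMeasure P]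
        {R : κ → Matrix (Fin M) (Fin M) ℂ} {H : κ → Ω → Matrix (Fin M) (Fin N) ℂ},
        IsKroneckerChannels P R H → ∀ (l : κ) {W : Ω → Matrix (Fin N) (Fin M) ℂ},
        (∀ ω, IsZeroInterferencePrecoder (Function.update G k (H l ω)) k (W ω)) →
      ∀ σ : ℝ, 0 ≤ σ → ∃ E : Set Ω, P E ≤ C * ENNReal.ofReal σ ^ (2 * (M * (N - M))) ∧
        ∀ ω ∉ E, ENNReal.ofReal (Real.logb 2 (1 + σ ^ 2)) ≤ interferenceLoss (H l ω) (W ω) := by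
  obtain ⟨C, hC, hball⟩ := exists_const_pi_stdComplexGaussian_mul_lt_le M (N - M)
  refine ⟨C, hC, ?_⟩
  intro ι _ _ hN G k hG Ω κ _ P _ R H hH l W hW σ hσ
  obtain ⟨Z, hZ, hHZ⟩ := hH.exists_hasLaw l
  -- the precoder of any one outcome fixes the projection for all outcomes
  obtain ⟨ω₀⟩ : Nonempty Ω := nonempty_of_isProbabilityMeasure P
  have hV := (hW ω₀).semiUnitary
  have hWV ω := mul_conjTranspose_eq_of_isZeroInterferencePrecoder hG hN (hW ω) (hW ω₀)
  obtain ⟨F, hF, hFV⟩ := exists_orthonormal_columns_orthogonal (W ω₀) (N - M)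
    (by simp only [Fintype.card_fin]; omega)
  have hVF := add_mul_conjTranspose_eq_one (by omega) hV hF hFV
  refine ⟨Z ⁻¹' {z | ∀ i m, ‖(Matrix.of (Function.curry z) * F) i m‖ₑ < ENNReal.ofReal σ *
    ∑ b, ∑ j, ‖(Matrix.of (Function.curry z) * W ω₀) b j‖ₑ}, ?_, fun ω hω => ?_⟩
  · refine (Measure.le_map_apply hZ.aemeasurable _).trans ?_
    rw [hZ.map_eq]
    exact hball (W ω₀) F hV hF hFV _
  · simp only [Set.mem_preimage, Set.mem_ofPred_eq, not_forall, not_lt] at hω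
    obtain ⟨i, m, him⟩ := hω
    rw [hHZ]
    refine logb_le_interferenceLoss_of_le_norm hVF (hWV ω) hσ (i := i) (m := m) ?_
    rw [sum_sum_enorm, ← ofReal_norm, ← ENNReal.ofReal_mul hσ] at him
    exact (ENNReal.ofReal_le_ofReal_iff (norm_nonneg _)).1 him

/-! ### Zero-forcing with combining -/

/-- The channels `z` for which some combiner `u`, normalized to have its largest entry `1` in
position `i`, aligns the effective channel `u ᵥ* z` with the direction `v`. -/
def alignedChannels {M N : ℕ} (v : Matrix (Fin N) (Fin 1) ℂ) (σ : ℝ) (i : Fin M) :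
    Set (Fin M × Fin N → ℂ) :=
  {z | ∃ u : Fin M → ℂ, u i = 1 ∧ (∀ j, ‖u j‖ ≤ 1) ∧
    ∑ n, ‖(u ᵥ* Matrix.of (Function.curry z)) n‖ ^ 2
      < (1 + σ ^ 2) * ‖((u ᵥ* Matrix.of (Function.curry z)) ᵥ* v) 0‖ ^ 2}

/-- A union of open sets, one for each combiner; in particular measurable, although nothing is assumed
about how the combiner depends on the channel. -/
theorem isOpen_alignedChannels {M N : ℕ} (v : Matrix (Fin N) (Fin 1) ℂ) (σ : ℝ) (i : Fin M) :
    IsOpen (alignedChannels v σ i) := by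
  have : alignedChannels v σ i = ⋃ u ∈ {u : Fin M → ℂ | u i = 1 ∧ ∀ j, ‖u j‖ ≤ 1},
      {z | ∑ n, ‖(u ᵥ* Matrix.of (Function.curry z)) n‖ ^ 2
        < (1 + σ ^ 2) * ‖((u ᵥ* Matrix.of (Function.curry z)) ᵥ* v) 0‖ ^ 2} := by
    ext z
    simp [alignedChannels, and_assoc]
  rw [this]
  refine isOpen_biUnion fun u _ => isOpen_lt ?_ ?_
  · simp only [Matrix.vecMul, dotProduct, Matrix.of_apply, Function.curry]
    fun_prop
  · simp only [Matrix.vecMul, dotProduct, Matrix.of_apply, Function.curry]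
    fun_prop

/-- A direction `f` orthogonal to `v` and to all rows of the channel but the `i`-th sees only the
`i`-th row; by Bessel's inequality its component along `f` is then small. -/
theorem norm_vecMul_lt_of_mem_alignedChannels {M N e : ℕ} {v : Matrix (Fin N) (Fin 1) ℂ}
    (hv : vᴴ * v = 1) {σ : ℝ} (hσ : 0 ≤ σ) {i : Fin M} {z : Fin M × Fin N → ℂ}
    (hz : z ∈ alignedChannels v σ i) {F : Matrix (Fin N) (Fin e) ℂ} (hF : Fᴴ * F = 1)
    (hFv : Fᴴ * v = 0) (hFz : ∀ j, j ≠ i → Function.curry z j ᵥ* F = 0) (m : Fin e) :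
    ‖(Function.curry z i ᵥ* F) m‖
      < σ * (‖(Function.curry z i ᵥ* v) 0‖
        + ∑ j ∈ Finset.univ.erase i, ‖(Function.curry z j ᵥ* v) 0‖) := by
  obtain ⟨u, hui, hu, hlt⟩ := hz
  obtain ⟨x, hx⟩ : ∃ x, x = u ᵥ* Matrix.of (Function.curry z) := ⟨_, rfl⟩
  rw [← hx] at hlt
  have hrow {a : ℕ} (X : Matrix (Fin N) (Fin a) ℂ) (b : Fin a) :
      (x ᵥ* X) b = ∑ j, u j * (Function.curry z j ᵥ* X) b := by
    rw [hx, Matrix.vecMul_vecMul]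
    rfl
  have hxF : (x ᵥ* F) m = (Function.curry z i ᵥ* F) m := by
    rw [hrow, Finset.sum_eq_single i, hui, one_mul]
    · intro j _ hj
      rw [hFz j hj, Pi.zero_apply, mul_zero]
    · simp
  have hxv : ‖(x ᵥ* v) 0‖ ≤ ‖(Function.curry z i ᵥ* v) 0‖
      + ∑ j ∈ Finset.univ.erase i, ‖(Function.curry z j ᵥ* v) 0‖ := by
    rw [hrow, Finset.add_sum_erase _ (fun j => ‖(Function.curry z j ᵥ* v) 0‖) (Finset.mem_univ i)]
    refine (norm_sum_le _ _).trans (Finset.sum_le_sum fun j _ => ?_)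
    rw [norm_mul]
    exact mul_le_of_le_one_left (norm_nonneg _) (hu j)
  have hvF : vᴴ * F = 0 := by simpa using congrArg Matrix.conjTranspose hFv
  have hbessel := sum_norm_vecMul_sq_le (V := Matrix.fromCols v F)
    (by rw [Matrix.conjTranspose_fromCols_eq_fromRows_conjTranspose, Matrix.fromRows_mul_fromCols,
      hv, hF, hFv, hvF, Matrix.fromBlocks_one]) x
  rw [Matrix.vecMul_fromCols, Fintype.sum_sum_type] at hbessel
  simp only [Sum.elim_inl, Sum.elim_inr, Fin.sum_univ_one] at hbessel
  have hm : ‖(x ᵥ* F) m‖ ^ 2 ≤ ∑ m, ‖(x ᵥ* F) m‖ ^ 2 :=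
    Finset.single_le_sum (f := fun m => ‖(x ᵥ* F) m‖ ^ 2) (fun _ _ => by positivity)
      (Finset.mem_univ m)
  have hsq : ‖(x ᵥ* F) m‖ ^ 2 < (σ * ‖(x ᵥ* v) 0‖) ^ 2 := by
    rw [mul_pow]; linarith
  rw [← hxF]
  exact (lt_of_pow_lt_pow_left₀ 2 (by positivity) hsq).trans_le
    (mul_le_mul_of_nonneg_left hxv hσ)

/-- Conditionally on the other rows, the `i`-th row of an aligned channel has to be small in `N - M`
orthonormal directions. -/
theorem exists_const_pi_alignedChannels_le (N M : ℕ) (hMN : M < N) :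
    ∃ C : ℝ≥0∞, C ≠ ⊤ ∧ ∀ (v : Matrix (Fin N) (Fin 1) ℂ), vᴴ * v = 1 → ∀ σ : ℝ, 0 ≤ σ →
      ∀ i : Fin M, (Measure.pi fun _ => stdComplexGaussian) (alignedChannels v σ i)
        ≤ C * ENNReal.ofReal σ ^ (2 * (N - M)) := by
  refine ⟨2 ^ (N - M) * ∫⁻ z : Fin M × Fin N → ℂ, ∫⁻ y : Fin 1 → ℂ,
    (∑ b, ‖y b‖ₑ + ∑ q, ‖z q‖ₑ) ^ (2 * (N - M)) ∂(Measure.pi fun _ => stdComplexGaussian)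
      ∂(Measure.pi fun _ => stdComplexGaussian),
    ENNReal.mul_ne_top (by simp) (lintegral_lintegral_sum_enorm_add_pow_lt_top _).ne, ?_⟩
  intro v hv σ hσ i
  have hmeas := (isOpen_alignedChannels v σ i).measurableSet
  have hres := measurePreserving_resample_row (ν := Fin N) i
  rw [← hres.measure_preimage hmeas.nullMeasurableSet,
    Measure.prod_apply (hres.measurable hmeas), mul_right_comm,
    ← lintegral_const_mul' _ _ (ENNReal.mul_ne_top (by simp) (by simp))]
  refine lintegral_mono fun z => ?_
  -- the rows other than `i`, conjugated since orthogonality is Hermitian, with `v` in column `i`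
  obtain ⟨F, hF, hFX⟩ := exists_orthonormal_columns_orthogonal
    (Matrix.of fun (n : Fin N) (j : Fin M) => if j = i then v n 0 else star (z (j, n))) (N - M)
    (by simp only [Fintype.card_fin]; omega)
  have hFv : Fᴴ * v = 0 := by
    ext m b
    have := congrFun (congrFun hFX m) i
    simpa [Matrix.mul_apply, Subsingleton.elim b 0] using this
  have hFz (j : Fin M) (hj : j ≠ i) : Function.curry z j ᵥ* F = 0 := by
    ext m
    have := congrArg star (congrFun (congrFun hFX m) j)
    simpa [Matrix.mul_apply, Matrix.vecMul, dotProduct, hj, mul_comm] using this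
  have hv1 (n : Fin N) : ‖v n 0‖ ≤ 1 := by
    have h1 := congrFun (congrFun hv 0) 0
    have h2 : ((∑ n, ‖v n 0‖ ^ 2 : ℝ) : ℂ) = 1 := by
      rw [ofReal_sum_norm_sq]
      simpa [Matrix.mul_apply, dotProduct, mul_comm] using h1
    have h3 : ∑ n, ‖v n 0‖ ^ 2 = 1 := by exact_mod_cast h2
    have h4 := Finset.single_le_sum (f := fun n => ‖v n 0‖ ^ 2) (fun _ _ => by positivity)
      (Finset.mem_univ n)
    rw [h3] at h4
    exact (sq_le_one_iff₀ (norm_nonneg _)).1 h4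
  obtain ⟨c, hc⟩ : ∃ c, c = ∑ j ∈ Finset.univ.erase i, ‖(Function.curry z j ᵥ* v) 0‖ₑ := ⟨_, rfl⟩
  have hcle : c ≤ ∑ q, ‖z q‖ₑ := by
    rw [hc, Fintype.sum_prod_type]
    refine (Finset.sum_le_sum_of_subset (Finset.erase_subset _ _)).trans
      (Finset.sum_le_sum fun j _ => ?_)
    refine (enorm_sum_le _ _).trans (Finset.sum_le_sum fun n _ => ?_)
    rw [enorm_mul]
    refine mul_le_of_le_one_right' ?_
    rw [← ofReal_norm]
    exact ENNReal.ofReal_le_one.2 (hv1 n)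
  have hball := pi_stdComplexGaussian_vecMul_lt_le F v hF hv hFv (ENNReal.ofReal σ) c
  rw [Fintype.card_fin] at hball
  refine (measure_mono fun h hh => ?_).trans (hball.trans (mul_le_mul_right
    (lintegral_mono fun y => pow_le_pow_left' (add_le_add_right hcle _) _) _))
  intro m
  have hcur (j : Fin M) : Function.curry
      (fun q : Fin M × Fin N => if q.1 = i then h q.2 else z q) j
      = if j = i then h else Function.curry z j := by
    ext n
    by_cases hj : j = i <;> simp [Function.curry, hj]
  have hlt := norm_vecMul_lt_of_mem_alignedChannels hv hσ hh hF hFv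
    (fun j hj => by rw [hcur, if_neg hj]; exact hFz j hj) m
  rw [hcur, if_pos rfl, Finset.sum_congr rfl fun j hj => by
    rw [hcur, if_neg (Finset.ne_of_mem_erase hj)]] at hlt
  rw [Fin.sum_univ_one, hc]
  simp only [← ofReal_norm]
  rw [← ENNReal.ofReal_sum_of_nonneg fun j _ => norm_nonneg _,
    ← ENNReal.ofReal_add (norm_nonneg _) (by positivity), ← ENNReal.ofReal_mul hσ]
  exact (ENNReal.ofReal_lt_ofReal_iff_of_nonneg (norm_nonneg _)).2 hlt

/-- The small-ball estimate for the loss of a single random user under zero-forcing, uniformly in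
the choice of the combiner. -/
theorem exists_const_measure_interferenceLoss_combined_lt_le (N M : ℕ) (hMN : M < N) :
    ∃ C : ℝ≥0∞, C ≠ ⊤ ∧ ∀ {ι : Type*} [Fintype ι] [DecidableEq ι], Fintype.card ι = N →
      ∀ {G : ι → Matrix (Fin 1) (Fin N) ℂ} {k : ι}, CoUsersIndependent G k →
      ∀ {Ω κ : Type*} [MeasurableSpace Ω] {P : Measure Ω} [IsProbabilityMeasure P]
        {R : κ → Matrix (Fin M) (Fin M) ℂ} {H : κ → Ω → Matrix (Fin M) (Fin N) ℂ},
        IsKroneckerChannels P R H → ∀ (l : κ) {c : Ω → Matrix (Fin M) (Fin 1) ℂ}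
        {W : Ω → Matrix (Fin N) (Fin 1) ℂ}, (∀ ω, IsSemiUnitary (c ω)) →
        (∀ ω, IsZeroInterferencePrecoder (Function.update G k ((c ω)ᴴ * H l ω)) k (W ω)) →
      ∀ σ : ℝ, 0 ≤ σ → ∃ E : Set Ω, P E ≤ C * ENNReal.ofReal σ ^ (2 * (N - M)) ∧
        ∀ ω ∉ E, ENNReal.ofReal (Real.logb 2 (1 + σ ^ 2))
          ≤ interferenceLoss ((c ω)ᴴ * H l ω) (W ω) := by
  obtain ⟨C, hC, hball⟩ := exists_const_pi_alignedChannels_le N M hMN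
  refine ⟨M * C, ENNReal.mul_ne_top (by simp) hC, ?_⟩
  intro ι _ _ hN G k hG Ω κ _ P _ R H hH l c W hc hW σ hσ
  obtain ⟨Z, hZ, hHZ⟩ := hH.exists_hasLaw l
  obtain ⟨ω₀⟩ : Nonempty Ω := nonempty_of_isProbabilityMeasure P
  have hV := (hW ω₀).semiUnitary
  have hWV ω := mul_conjTranspose_eq_of_isZeroInterferencePrecoder hG (by omega) (hW ω) (hW ω₀)
  refine ⟨Z ⁻¹' ⋃ i, alignedChannels (W ω₀) σ i, ?_, fun ω hω => ?_⟩
  · refine (Measure.le_map_apply hZ.aemeasurable _).trans ?_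
    rw [hZ.map_eq]
    refine (measure_iUnion_fintype_le _ _).trans
      ((Finset.sum_le_sum fun i _ => hball (W ω₀) hV σ hσ i).trans_eq ?_)
    rw [Finset.sum_const, Finset.card_univ, Fintype.card_fin, nsmul_eq_mul, mul_assoc]
  · refine logb_le_interferenceLoss_row (hWV ω) ?_
    obtain ⟨a, ha⟩ : ∃ a : Fin M → ℂ, a = ((c ω)ᴴ * CFC.sqrt (R l)) 0 := ⟨_, rfl⟩
    have hGa : ((c ω)ᴴ * H l ω) 0 = a ᵥ* Matrix.of (Function.curry (Z ω)) := by
      rw [hHZ, ← Matrix.mul_assoc, ha]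
      rfl
    have ha0 : a ≠ 0 := by
      intro h0
      have h1 : (c ω)ᴴ * CFC.sqrt (R l) = 0 := by
        ext i j
        rw [Subsingleton.elim i 0, ← ha, h0]
        rfl
      have h2 : (c ω)ᴴ = 0 := by
        have := congrArg (· * (CFC.sqrt (R l))⁻¹) h1
        simpa [Matrix.mul_assoc, Matrix.mul_nonsing_inv _
          (isUnit_iff_ne_zero.2 (det_sqrt_ne_zero (hH.1 l)))] using this
      have h3 := hc ω
      rw [IsSemiUnitary, h2, Matrix.zero_mul] at h3
      simpa using congrFun (congrFun h3 0) 0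
    obtain ⟨j₀, hj₀⟩ := Function.ne_iff.1 ha0
    -- dividing by the largest coefficient brings the combination into the form of `alignedChannels`
    obtain ⟨i, -, hi⟩ := Finset.exists_max_image Finset.univ (fun j => ‖a j‖) ⟨j₀, Finset.mem_univ _⟩
    have hai : 0 < ‖a i‖ := (norm_pos_iff.2 hj₀).trans_le (hi j₀ (Finset.mem_univ _))
    have hai0 : a i ≠ 0 := norm_pos_iff.1 hai
    obtain ⟨u, hu⟩ : ∃ u : Fin M → ℂ, u = (a i)⁻¹ • a := ⟨_, rfl⟩
    have hau : a = a i • u := by rw [hu, smul_inv_smul₀ hai0]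
    by_contra! hlt
    refine hω (Set.mem_iUnion_of_mem i ⟨u, ?_, fun j => ?_, ?_⟩)
    · rw [hu, Pi.smul_apply, smul_eq_mul, inv_mul_cancel₀ hai0]
    · rw [hu, Pi.smul_apply, norm_smul, norm_inv, inv_mul_le_one₀ hai]
      exact hi j (Finset.mem_univ _)
    · rw [hGa, hau] at hlt
      simp only [Matrix.smul_vecMul, Pi.smul_apply, norm_smul, mul_pow] at hlt
      rw [← Finset.mul_sum, mul_left_comm] at hlt
      exact lt_of_mul_lt_mul_left hlt (by positivity)

/-! ### The expected loss of the best user -/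

theorem theorem2 (N M : ℕ) (hM : 1 ≤ M) (hMN : M < N) :
    -- block-diagonalization
    (∃ c₁ : ℝ, 0 < c₁ ∧ ∃ K₀ : ℕ, 1 ≤ K₀ ∧ ∀ K : ℕ, K₀ ≤ K →
      c₁ * (K : ℝ) ^ (-(1 / ((M : ℝ) * ((N : ℝ) - (M : ℝ))))) < 1 ∧
      ∀ (n : ℕ), n * M = N →
      -- the given scheduling set of `n = N / M` users, and the user that is replaced
      ∀ (H : Fin n → Matrix (Fin M) (Fin N) ℂ) (k : Fin n), CoUsersIndependent H k →
      -- the channels of the `K` random users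
      ∀ (Ω : Type*) [MeasurableSpace Ω] (P : Measure Ω) [IsProbabilityMeasure P]
        (R : Fin K → Matrix (Fin M) (Fin M) ℂ) (Hc : Fin K → Ω → Matrix (Fin M) (Fin N) ℂ),
        IsKroneckerChannels P R Hc →
      -- the precoding matrix of each of them, when put in the place of user `k`
      ∀ (W : Fin K → Ω → Matrix (Fin N) (Fin M) ℂ),
        (∀ l ω, IsZeroInterferencePrecoder (Function.update H k (Hc l ω)) k (W l ω)) →
        ENNReal.ofReal (-(M : ℝ) *
            Real.logb 2 (1 - c₁ * (K : ℝ) ^ (-(1 / ((M : ℝ) * ((N : ℝ) - (M : ℝ)))))))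
          ≤ ∫⁻ ω, ⨅ l : Fin K, interferenceLoss (Hc l ω) (W l ω) ∂P) ∧
    -- zero-forcing with combining
    (∃ c₂ : ℝ, 0 < c₂ ∧ ∃ K₀ : ℕ, 1 ≤ K₀ ∧ ∀ K : ℕ, K₀ ≤ K →
      c₂ * (K : ℝ) ^ (-(1 / ((N : ℝ) - (M : ℝ)))) < 1 ∧
      -- the channels and combiners of the given scheduling set, and the user that is replaced
      ∀ (H : Fin N → Matrix (Fin M) (Fin N) ℂ) (c : Fin N → Matrix (Fin M) (Fin 1) ℂ) (k : Fin N),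
        (∀ j, IsSemiUnitary (c j)) → CoUsersIndependent (fun j => (c j)ᴴ * H j) k →
      -- the channels of the `K` random users
      ∀ (Ω : Type*) [MeasurableSpace Ω] (P : Measure Ω) [IsProbabilityMeasure P]
        (R : Fin K → Matrix (Fin M) (Fin M) ℂ) (Hc : Fin K → Ω → Matrix (Fin M) (Fin N) ℂ),
        IsKroneckerChannels P R Hc →
      -- their combiners, chosen in any way, and precoding vectors in the place of user `k`
      ∀ (cc : Fin K → Ω → Matrix (Fin M) (Fin 1) ℂ) (w : Fin K → Ω → Matrix (Fin N) (Fin 1) ℂ),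
        (∀ l ω, IsSemiUnitary (cc l ω)) →
        (∀ l ω, IsZeroInterferencePrecoder
          (Function.update (fun j => (c j)ᴴ * H j) k ((cc l ω)ᴴ * Hc l ω)) k (w l ω)) →
        ENNReal.ofReal (-
            Real.logb 2 (1 - c₂ * (K : ℝ) ^ (-(1 / ((N : ℝ) - (M : ℝ))))))
          ≤ ∫⁻ ω, ⨅ l : Fin K, interferenceLoss ((cc l ω)ᴴ * Hc l ω) (w l ω) ∂P) := by
  have hcast : ((N - M : ℕ) : ℝ) = (N : ℝ) - M := Nat.cast_sub hMN.le
  have hsub : 1 ≤ N - M := by omega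
  constructor
  · obtain ⟨C, hC, hball⟩ := exists_const_measure_interferenceLoss_lt_le N M hMN
    obtain ⟨c, hc, h⟩ := exists_const_le_lintegral_iInf (M * (N - M))
      (Nat.mul_pos hM hsub) C hC M hM
    simp only [Nat.cast_mul, hcast] at h
    refine ⟨c, hc, 1, le_rfl, fun K hK => ⟨(h K hK).1, ?_⟩⟩
    intro n hn H k hG Ω _ P _ R Hc hHc W hW
    exact (h K hK).2 Ω P (fun l ω => interferenceLoss (Hc l ω) (W l ω)) fun l σ hσ =>
      hball (by rw [Fintype.card_fin, hn]) hG hHc l (hW l) σ hσ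
  · obtain ⟨C, hC, hball⟩ := exists_const_measure_interferenceLoss_combined_lt_le N M hMN
    obtain ⟨c, hc, h⟩ := exists_const_le_lintegral_iInf (N - M) hsub C hC 1 le_rfl
    simp only [Nat.cast_one, neg_mul, one_mul, hcast] at h
    refine ⟨c, hc, 1, le_rfl, fun K hK => ⟨(h K hK).1, ?_⟩⟩
    intro H cs k _ hG Ω _ P _ R Hc hHc cc w hcc hw
    exact (h K hK).2 Ω P (fun l ω => interferenceLoss ((cc l ω)ᴴ * Hc l ω) (w l ω)) fun l σ hσ =>
      hball (Fintype.card_fin N) hG hHc l (hcc l) (hw l) σ hσ
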